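/- Let $Q$ be a loop, that is, a set with a binary operation $(x,y)\mapsto xy$ and an element $1$ with $1x=x=x1$ for all $x\in Q$, such that for all $a,b\in Q$ there are unique $x,y\in Q$ with $ax=b$ and $ya=b$. For $a\in Q$ let $L_a\colon x\mapsto ax$ and $R_a\colon x\mapsto xa$ be the left and right translations, let $\mathrm{Mlt}(Q)=\langle L_a,R_a : a\in Q\rangle$ be the group of permutations of $Q$ that they generate, and let $\mathrm{Inn}(Q)$ be the subgroup of those elements of $\mathrm{Mlt}(Q)$ that fix $1$. The loop $Q$ is called automorphic if every element of $\mathrm{Inn}(Q)$ is an automorphism of $Q$. If $Q$ is an automorphic loop of (finite) odd order, then for all $x,y\in Q$, $$x(xy)=(yx)x \quad\text{if and only if}\quad xy=yx.$$ -/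

import Mathlib

/-- A loop: a set with a binary operation having a two-sided identity element `1`, such that for
all `a`, `b` each of the equations `a * x = b` and `y * a = b` has exactly one solution. -/
class Loop (L : Type*) extends MulOneClass L where
  existsUnique_mul_left_eq : ∀ a b : L, ∃! x : L, a * x = b
  existsUnique_mul_right_eq : ∀ a b : L, ∃! y : L, y * a = b

namespace Loop

variable {L : Type*} [Loop L]

theorem bijective_mul_left (a : L) : Function.Bijective (fun x : L => a * x) :=
  (Function.bijective_iff_existsUnique _).2 (existsUnique_mul_left_eq a)

theorem bijective_mul_right (a : L) : Function.Bijective (fun x : L => x * a) :=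
  (Function.bijective_iff_existsUnique _).2 (existsUnique_mul_right_eq a)

/-- The left translation `x ↦ a * x`. -/
noncomputable def leftTranslation (a : L) : Equiv.Perm L :=
  Equiv.ofBijective (fun x => a * x) (bijective_mul_left a)

/-- The right translation `x ↦ x * a`. -/
noncomputable def rightTranslation (a : L) : Equiv.Perm L :=
  Equiv.ofBijective (fun x => x * a) (bijective_mul_right a)

variable (L) in
/-- The multiplication group: the group of permutations of `L` generated by all translations. -/
def multiplicationGroup : Subgroup (Equiv.Perm L) :=
  Subgroup.closure (Set.range (rightTranslation (L := L)) ∪ Set.range (leftTranslation (L := L)))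

variable (L) in
/-- The inner mapping group: the stabilizer of the identity element in the multiplication group. -/
def innerMappingGroup : Subgroup (Equiv.Perm L) :=
  multiplicationGroup L ⊓ MulAction.stabilizer (Equiv.Perm L) (1 : L)

variable (L) in
/-- A loop is automorphic if every inner mapping is an automorphism. (Inner mappings are
permutations, so only multiplicativity has to be required.) -/
def IsAutomorphic : Prop :=
  ∀ φ ∈ innerMappingGroup L, ∀ x y : L, φ (x * y) = φ x * φ y

end Loop

/-! Write `T = R_x⁻¹ L_x`. Flexibility makes `L_x` and `R_x` commute, so the left identity says `T²
y = y` and the right one `T y = y`. With `J` the inversion, let `s_m = L_m J L_m⁻¹` be the point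
reflection at `m`; elements `g` of the multiplication group satisfy `g s_m g⁻¹ = s_{g m}`. In odd
order any two points have a unique midpoint, so if `T` swaps `y` and `T y`, it fixes their midpoint
`m`. Writing `y = m u` gives `T u = u⁻¹`, hence `(x u)² = x²`, hence `u = 1` and `y = m`.

Unique midpoints amount to injective squaring (`mul_self_injective`). The maps `P_x = s_x J` satisfy
`P_x² = P_{x²}` and have odd order, so `x²` determines `P_x`, and `x` by `reflection_injective`.
Both facts rest on `eq_one_of_reflection_eq_inversion`, proved by induction through fixed subloops
of inner involutions. -/

theorem perm_apply_inv_self {α : Type*} (g : Equiv.Perm α) (x : α) : g (g⁻¹ x) = x :=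
  g.apply_symm_apply x

theorem perm_inv_apply_self {α : Type*} (g : Equiv.Perm α) (x : α) : g⁻¹ (g x) = x :=
  g.symm_apply_apply x

namespace Loop

variable {Q : Type*} [Loop Q]

instance : IsCancelMul Q where
  mul_left_cancel a _ _ h := (bijective_mul_left a).1 h
  mul_right_cancel a _ _ h := (bijective_mul_right a).1 h

@[simp] theorem leftTranslation_apply (a x : Q) : leftTranslation a x = a * x := rfl

@[simp] theorem rightTranslation_apply (a x : Q) : rightTranslation a x = x * a := rfl

theorem mul_leftTranslation_inv (a x : Q) : a * (leftTranslation a)⁻¹ x = x :=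
  (leftTranslation a).apply_symm_apply x

@[simp] theorem leftTranslation_inv_mul (a x : Q) : (leftTranslation a)⁻¹ (a * x) = x :=
  (leftTranslation a).symm_apply_apply x

theorem rightTranslation_inv_mul (a x : Q) : (rightTranslation a)⁻¹ x * a = x :=
  (rightTranslation a).apply_symm_apply x

@[simp] theorem rightTranslation_inv_apply_mul (a x : Q) :
    (rightTranslation a)⁻¹ (x * a) = x :=
  (rightTranslation a).symm_apply_apply x

theorem leftTranslation_mem (a : Q) : leftTranslation a ∈ multiplicationGroup Q :=
  Subgroup.subset_closure (Or.inr ⟨a, rfl⟩)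

theorem rightTranslation_mem (a : Q) : rightTranslation a ∈ multiplicationGroup Q :=
  Subgroup.subset_closure (Or.inl ⟨a, rfl⟩)

theorem mem_innerMappingGroup {g : Equiv.Perm Q} :
    g ∈ innerMappingGroup Q ↔ g ∈ multiplicationGroup Q ∧ g 1 = 1 := by
  simp [innerMappingGroup, Subgroup.mem_inf, MulAction.mem_stabilizer_iff]

/-- The middle inner mapping `y ↦ (x * y) / x`. -/
noncomputable def middleInner (x : Q) : Equiv.Perm Q :=
  (rightTranslation x)⁻¹ * leftTranslation x

theorem middleInner_mem (x : Q) : middleInner x ∈ innerMappingGroup Q := by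
  refine mem_innerMappingGroup.2 ⟨mul_mem (inv_mem (rightTranslation_mem x))
    (leftTranslation_mem x), ?_⟩
  have := rightTranslation_inv_apply_mul x 1
  simpa [middleInner] using this

/-- The right inverse of an element. -/
noncomputable def inverse (x : Q) : Q := (leftTranslation x)⁻¹ 1

theorem mul_inverse (x : Q) : x * inverse x = 1 := mul_leftTranslation_inv x 1

theorem eq_inverse_of_mul {x y : Q} (h : x * y = 1) : y = inverse x :=
  mul_left_cancel (h.trans (mul_inverse x).symm)

@[simp] theorem inverse_one : inverse (1 : Q) = 1 := (eq_inverse_of_mul (one_mul 1)).symm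

namespace IsAutomorphic




/-! ### Flexibility and inverses -/

/-- The automorphism `T_x` fixes `x`; apply it to the product of `x` and `x \ (y x)`. -/
theorem flexible (hQ : IsAutomorphic Q) (x y : Q) : x * (y * x) = (x * y) * x := by
  have h := hQ _ (middleInner_mem x) x ((leftTranslation x)⁻¹ (y * x))
  have hx : middleInner x x = x := rightTranslation_inv_apply_mul x x
  rw [hx, mul_leftTranslation_inv] at h
  simp only [middleInner, Equiv.Perm.mul_apply, leftTranslation_apply, mul_leftTranslation_inv,
    rightTranslation_inv_apply_mul] at h
  rw [← h, rightTranslation_inv_mul]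

theorem inverse_mul (hQ : IsAutomorphic Q) (x : Q) : inverse x * x = 1 :=
  mul_left_cancel (a := x) (by rw [hQ.flexible, mul_inverse, one_mul, mul_one])

theorem inverse_inverse (hQ : IsAutomorphic Q) (x : Q) : inverse (inverse x) = x :=
  (eq_inverse_of_mul (hQ.inverse_mul x)).symm

theorem map_one {φ : Equiv.Perm Q} (hφ : φ ∈ innerMappingGroup Q) : φ 1 = 1 :=
  (mem_innerMappingGroup.1 hφ).2

theorem map_inverse (hQ : IsAutomorphic Q) {φ : Equiv.Perm Q} (hφ : φ ∈ innerMappingGroup Q)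
    (x : Q) : φ (inverse x) = inverse (φ x) :=
  eq_inverse_of_mul (by rw [← hQ φ hφ, mul_inverse, map_one hφ])

/-- The inner mapping `z ↦ (x * y) \ (x * (y⁻¹ \ z))`. -/
theorem leftInner_mem (hQ : IsAutomorphic Q) (x y : Q) :
    (leftTranslation (x * y))⁻¹ * leftTranslation x * (leftTranslation (inverse y))⁻¹ ∈
      innerMappingGroup Q := by
  refine mem_innerMappingGroup.2 ⟨mul_mem (mul_mem (inv_mem (leftTranslation_mem _))
    (leftTranslation_mem _)) (inv_mem (leftTranslation_mem _)), ?_⟩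
  have h1 : (leftTranslation (inverse y))⁻¹ 1 = y := by
    rw [← hQ.inverse_mul y, leftTranslation_inv_mul]
  have h2 := leftTranslation_inv_mul (x * y) 1
  simp only [Equiv.Perm.mul_apply, h1, leftTranslation_apply]
  simpa using h2

theorem leftInner_apply_mul (hQ : IsAutomorphic Q) (x y : Q) :
    ((leftTranslation (x * y))⁻¹ * leftTranslation x * (leftTranslation (inverse y))⁻¹) (x * y) =
      x * y := by
  -- Call the mapping `φ` and put `c = (x y) \ x`. Then `φ y⁻¹ = c`, and flexibility gives `φ (y⁻¹
  -- (x y)) = c (x y)`; cancel `c`.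
  have h := hQ _ (hQ.leftInner_mem x y) (inverse y) (x * y)
  set a := x * y with ha
  have h1 := leftTranslation_inv_mul (inverse y) 1
  rw [mul_one] at h1
  simp only [Equiv.Perm.mul_apply, leftTranslation_apply, leftTranslation_inv_mul, h1, mul_one]
    at h ⊢
  set c := (leftTranslation a)⁻¹ x with hc
  have hac : a * c = x := mul_leftTranslation_inv a x
  have h2 : x * a = a * (c * a) := by rw [hQ.flexible, hac]
  rw [h2, leftTranslation_inv_mul] at h
  exact (mul_left_cancel h).symm

theorem mul_self_mul (hQ : IsAutomorphic Q) (x y : Q) :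
    (x * y) * (x * y) = x * (leftTranslation (inverse y))⁻¹ (x * y) := by
  conv_lhs => rw [← hQ.leftInner_apply_mul x y]
  conv_lhs => arg 1; rw [hQ.leftInner_apply_mul x y]
  simp only [Equiv.Perm.mul_apply, leftTranslation_apply, mul_leftTranslation_inv]

/-- The antiautomorphic inverse property. -/
theorem inverse_mul_rev (hQ : IsAutomorphic Q) (x y : Q) :
    inverse (x * y) = inverse y * inverse x := by
  have h := hQ.map_inverse (hQ.leftInner_mem x y) (x * y)
  rw [hQ.leftInner_apply_mul] at h
  simp only [Equiv.Perm.mul_apply, leftTranslation_apply] at h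
  have h1 := congrArg (fun z => x * y * z) h
  simp only [mul_leftTranslation_inv, mul_inverse] at h1
  rw [← eq_inverse_of_mul h1, mul_leftTranslation_inv]

/-! ### Point reflections -/

/-- Inversion as a permutation. -/
noncomputable def inversion (hQ : IsAutomorphic Q) : Equiv.Perm Q :=
  Function.Involutive.toPerm inverse hQ.inverse_inverse

@[simp] theorem inversion_apply (hQ : IsAutomorphic Q) (x : Q) :
    hQ.inversion x = inverse x := rfl

theorem inversion_mul_self (hQ : IsAutomorphic Q) : hQ.inversion * hQ.inversion = 1 :=
  Equiv.ext hQ.inverse_inverse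

theorem inversion_inv (hQ : IsAutomorphic Q) : hQ.inversion⁻¹ = hQ.inversion :=
  inv_eq_of_mul_eq_one_left hQ.inversion_mul_self

theorem inner_commute_inversion (hQ : IsAutomorphic Q) {φ : Equiv.Perm Q}
    (hφ : φ ∈ innerMappingGroup Q) : Commute φ hQ.inversion :=
  Equiv.ext fun x => hQ.map_inverse hφ x

theorem inversion_mul_leftTranslation (hQ : IsAutomorphic Q) (x : Q) :
    hQ.inversion * leftTranslation x = rightTranslation (inverse x) * hQ.inversion :=
  Equiv.ext fun z => hQ.inverse_mul_rev x z

/-- The point reflection at `x`: inversion conjugated by the translation that moves `1` to `x`. -/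
noncomputable def reflection (hQ : IsAutomorphic Q) (x : Q) : Equiv.Perm Q :=
  leftTranslation x * hQ.inversion * (leftTranslation x)⁻¹

theorem reflection_mul_self (hQ : IsAutomorphic Q) (x : Q) :
    hQ.reflection x * hQ.reflection x = 1 := by
  have := hQ.inversion_mul_self
  calc _ = leftTranslation x * (hQ.inversion * hQ.inversion) * (leftTranslation x)⁻¹ := by
        unfold reflection; group
    _ = 1 := by rw [this]; group

theorem reflection_inv (hQ : IsAutomorphic Q) (x : Q) :
    (hQ.reflection x)⁻¹ = hQ.reflection x :=
  inv_eq_of_mul_eq_one_left (hQ.reflection_mul_self x)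

@[simp] theorem reflection_one (hQ : IsAutomorphic Q) : hQ.reflection 1 = hQ.inversion := by
  have : leftTranslation (1 : Q) = 1 := Equiv.ext fun z => one_mul z
  simp [reflection, this]

theorem reflection_apply_one (hQ : IsAutomorphic Q) (x : Q) : hQ.reflection x 1 = x * x := by
  change x * inverse (inverse x) = x * x
  rw [hQ.inverse_inverse]

/-- `g` is `L_{g 1}` times an inner mapping, and inner mappings commute with inversion. -/
theorem conj_inversion (hQ : IsAutomorphic Q) {g : Equiv.Perm Q}
    (hg : g ∈ multiplicationGroup Q) : g * hQ.inversion * g⁻¹ = hQ.reflection (g 1) := by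
  have hh : (leftTranslation (g 1))⁻¹ * g ∈ innerMappingGroup Q := by
    refine mem_innerMappingGroup.2 ⟨mul_mem (inv_mem (leftTranslation_mem _)) hg, ?_⟩
    have := leftTranslation_inv_mul (g 1) 1
    rwa [mul_one] at this
  have hc := (hQ.inner_commute_inversion hh).eq
  calc g * hQ.inversion * g⁻¹
      = leftTranslation (g 1) * (((leftTranslation (g 1))⁻¹ * g) * hQ.inversion) * g⁻¹ := by group
    _ = hQ.reflection (g 1) := by rw [hc]; unfold reflection; group

theorem conj_reflection (hQ : IsAutomorphic Q) {g : Equiv.Perm Q}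
    (hg : g ∈ multiplicationGroup Q) (w : Q) :
    g * hQ.reflection w * g⁻¹ = hQ.reflection (g w) := by
  have h := hQ.conj_inversion (mul_mem hg (leftTranslation_mem w))
  simp only [Equiv.Perm.mul_apply, leftTranslation_apply, mul_one] at h
  rw [← h]
  unfold reflection; group

theorem reflection_mul_inversion (hQ : IsAutomorphic Q) (x : Q) :
    hQ.reflection x * hQ.inversion = leftTranslation x * (rightTranslation (inverse x))⁻¹ := by
  have h : (rightTranslation (inverse x))⁻¹ =
      hQ.inversion * (leftTranslation x)⁻¹ * hQ.inversion := by
    have h1 := congrArg (fun g => (g * hQ.inversion)⁻¹) (hQ.inversion_mul_leftTranslation x)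
    simp only [mul_assoc, hQ.inversion_mul_self, mul_one] at h1
    rw [← h1]
    simp only [mul_inv_rev, hQ.inversion_inv]
  rw [h]; unfold reflection; group

theorem reflection_mul_inversion_mem (hQ : IsAutomorphic Q) (x : Q) :
    hQ.reflection x * hQ.inversion ∈ multiplicationGroup Q := by
  rw [hQ.reflection_mul_inversion]
  exact mul_mem (leftTranslation_mem _) (inv_mem (rightTranslation_mem _))

theorem reflection_mul_inversion_sq (hQ : IsAutomorphic Q) (x : Q) :
    (hQ.reflection x * hQ.inversion) ^ 2 = hQ.reflection (x * x) * hQ.inversion := by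
  have h := hQ.conj_inversion (hQ.reflection_mul_inversion_mem x)
  rw [Equiv.Perm.mul_apply, inversion_apply, inverse_one, reflection_apply_one] at h
  rw [← h, mul_inv_rev, hQ.reflection_inv, hQ.inversion_inv, pow_two]
  simp only [mul_assoc, hQ.inversion_mul_self, mul_one]

theorem exists_pow_eq_reflection_mul_inversion (hQ : IsAutomorphic Q) (x : Q) (n : ℕ) :
    ∃ u, (hQ.reflection x * hQ.inversion) ^ n = hQ.reflection u * hQ.inversion := by
  induction n using Nat.twoStepInduction with
  | zero => exact ⟨1, by simp [hQ.inversion_mul_self]⟩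
  | one => exact ⟨x, by simp⟩
  | more n ih _ =>
    obtain ⟨w, hw⟩ := ih
    set a := hQ.reflection x * hQ.inversion with ha
    -- Inversion inverts `a` under conjugation, so `a s_w J a = a s_w a⁻¹ J = s_{a w} J`.
    refine ⟨a w, ?_⟩
    have hinv : a⁻¹ * hQ.inversion = hQ.inversion * a := by
      rw [ha, mul_inv_rev, hQ.reflection_inv, hQ.inversion_inv, mul_assoc]
    rw [← hQ.conj_reflection (hQ.reflection_mul_inversion_mem x) w, ← ha, mul_assoc _ a⁻¹, hinv]
    calc a ^ (n + 2) = a * a ^ n * a := by rw [pow_succ, pow_succ']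
      _ = _ := by rw [hw]; group

/-- The reflection at `v` is inversion iff `v` squares to `1` and commutes with every element. -/
theorem reflection_eq_inversion_iff (hQ : IsAutomorphic Q) (v : Q) :
    hQ.reflection v = hQ.inversion ↔ v * v = 1 ∧ ∀ z, v * z = z * v := by
  constructor
  · intro h
    have hv : v * v = 1 := by rw [← hQ.reflection_apply_one, h, inversion_apply, inverse_one]
    refine ⟨hv, fun z => ?_⟩
    have h1 := hQ.reflection_mul_inversion v
    rw [h, hQ.inversion_mul_self, ← eq_inverse_of_mul hv, eq_comm, mul_inv_eq_one] at h1
    exact congrArg (fun g : Equiv.Perm Q => g z) h1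
  · rintro ⟨hv, hz⟩
    have h1 := hQ.reflection_mul_inversion v
    have h2 : leftTranslation v = rightTranslation v := Equiv.ext hz
    rw [← eq_inverse_of_mul hv, h2, mul_inv_cancel] at h1
    rw [mul_eq_one_iff_eq_inv.1 h1, hQ.inversion_inv]

/-! ### Fixed subloops of inner mappings -/

/-- The fixed points of an inner mapping form a loop. -/
noncomputable abbrev fixedLoop (hQ : IsAutomorphic Q) {t : Equiv.Perm Q}
    (ht : t ∈ innerMappingGroup Q) : Loop {z : Q // t z = z} where
  mul a b := ⟨a * b, by rw [hQ t ht, a.2, b.2]⟩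
  one := ⟨1, map_one ht⟩
  one_mul a := Subtype.ext (one_mul a.1)
  mul_one a := Subtype.ext (mul_one a.1)
  existsUnique_mul_left_eq a b := by
    refine ⟨⟨(leftTranslation a.1)⁻¹ b.1, ?_⟩, Subtype.ext (mul_leftTranslation_inv _ _), ?_⟩
    · apply mul_left_cancel (a := a.1)
      have h := hQ t ht a.1 ((leftTranslation a.1)⁻¹ b.1)
      rw [mul_leftTranslation_inv, a.2, b.2] at h
      rw [mul_leftTranslation_inv, ← h]
    · intro y hy
      apply Subtype.ext
      apply mul_left_cancel (a := a.1)
      rw [mul_leftTranslation_inv]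
      exact congrArg Subtype.val hy
  existsUnique_mul_right_eq a b := by
    refine ⟨⟨(rightTranslation a.1)⁻¹ b.1, ?_⟩, Subtype.ext (rightTranslation_inv_mul _ _), ?_⟩
    · apply mul_right_cancel (b := a.1)
      have h := hQ t ht ((rightTranslation a.1)⁻¹ b.1) a.1
      rw [rightTranslation_inv_mul, a.2, b.2] at h
      rw [rightTranslation_inv_mul, ← h]
    · intro y hy
      apply Subtype.ext
      apply mul_right_cancel (b := a.1)
      rw [rightTranslation_inv_mul]
      exact congrArg Subtype.val hy

/-- Makes each inner mapping of the fixed loop a restriction of one of `Q`, so the fixed loop is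
again automorphic. -/
theorem exists_lift_fixedLoop (hQ : IsAutomorphic Q) {t : Equiv.Perm Q}
    (ht : t ∈ innerMappingGroup Q) :
    letI := hQ.fixedLoop ht
    ∀ g ∈ multiplicationGroup {z : Q // t z = z},
      ∃ h ∈ multiplicationGroup Q, ∀ z, (g z).1 = h z.1 := by
  let := hQ.fixedLoop ht
  intro g hg
  induction hg using Subgroup.closure_induction with
  | mem g hg =>
    rcases hg with ⟨a, rfl⟩ | ⟨a, rfl⟩
    · exact ⟨_, rightTranslation_mem a.1, fun z => rfl⟩
    · exact ⟨_, leftTranslation_mem a.1, fun z => rfl⟩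
  | one => exact ⟨1, one_mem _, fun z => rfl⟩
  | mul g₁ g₂ _ _ ih₁ ih₂ =>
    obtain ⟨h₁, hm₁, e₁⟩ := ih₁
    obtain ⟨h₂, hm₂, e₂⟩ := ih₂
    exact ⟨h₁ * h₂, mul_mem hm₁ hm₂, fun z => by
      rw [Equiv.Perm.mul_apply, Equiv.Perm.mul_apply, e₁, e₂]⟩
  | inv g _ ih =>
    obtain ⟨h, hm, e⟩ := ih
    refine ⟨h⁻¹, inv_mem hm, fun z => ?_⟩
    rw [Equiv.Perm.eq_inv_iff_eq, ← e, perm_apply_inv_self]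

theorem fixedLoop_isAutomorphic (hQ : IsAutomorphic Q) {t : Equiv.Perm Q}
    (ht : t ∈ innerMappingGroup Q) :
    letI := hQ.fixedLoop ht
    IsAutomorphic {z : Q // t z = z} := by
  let := hQ.fixedLoop ht
  intro φ hφ x y
  obtain ⟨h1, h2⟩ := mem_innerMappingGroup.1 hφ
  obtain ⟨h, hm, e⟩ := hQ.exists_lift_fixedLoop ht φ h1
  have hh : h ∈ innerMappingGroup Q := by
    refine mem_innerMappingGroup.2 ⟨hm, ?_⟩
    have := e 1
    rw [h2] at this
    exact this.symm
  apply Subtype.ext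
  rw [e]
  change h (x.1 * y.1) = (φ x).1 * (φ y).1
  rw [e, e, hQ h hh]

end IsAutomorphic

/-! ### Involutions and odd orders -/

theorem odd_card_fixed_of_involution {α : Type*} (hodd : Odd (Nat.card α)) (s : Equiv.Perm α)
    (hs : s * s = 1) : Odd (Nat.card {z : α // s z = z}) := by
  classical
  have : Finite α := Nat.finite_of_card_ne_zero fun h => by simp [h] at hodd
  have := Fintype.ofFinite α
  have h := Equiv.Perm.card_fixedPoints_modEq (f := (fun z => s z : α → α)) (p := 2) (n := 1)
    (by funext z; exact congrArg (fun g : Equiv.Perm α => g z) hs)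
  rw [← Nat.card_eq_fintype_card, ← Nat.card_eq_fintype_card] at h
  rw [Nat.odd_iff] at hodd ⊢
  have h2 : Nat.card {z : α // s z = z} % 2 = Nat.card α % 2 := h.symm
  rw [h2, hodd]

theorem exists_involution_pow {G : Type*} [Group G] [Finite G] (g : G)
    (h : Even (orderOf g)) : ∃ n : ℕ, g ^ n ≠ 1 ∧ g ^ n * g ^ n = 1 := by
  obtain ⟨n, hn⟩ := h
  have hpos := orderOf_pos g
  refine ⟨n, fun h1 => ?_, by rw [← pow_add, ← hn, pow_orderOf_eq_one]⟩
  have := Nat.le_of_dvd (by omega) (orderOf_dvd_of_pow_eq_one h1)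
  omega

theorem sq_pow_eq_self_of_odd {G : Type*} [Group G] {g : G} {m : ℕ} (hg : g ^ m = 1)
    (hm : Odd m) : (g ^ 2) ^ ((m + 1) / 2) = g := by
  obtain ⟨k, rfl⟩ := hm
  rw [← pow_mul, show 2 * ((2 * k + 1 + 1) / 2) = 2 * k + 1 + 1 by omega, pow_succ, hg, one_mul]

theorem eq_of_sq_eq_sq_of_odd_orderOf {G : Type*} [Group G] {g h : G} (hg : Odd (orderOf g))
    (hh : Odd (orderOf h)) (hs : g ^ 2 = h ^ 2) : g = h := by
  -- With a common odd exponent, `g` and `h` are the same power of their squares.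
  have e1 := sq_pow_eq_self_of_odd (g := g) (m := orderOf g * orderOf h)
    (by rw [pow_mul, pow_orderOf_eq_one, one_pow]) (hg.mul hh)
  have e2 := sq_pow_eq_self_of_odd (g := h) (m := orderOf g * orderOf h)
    (by rw [mul_comm, pow_mul, pow_orderOf_eq_one, one_pow]) (hg.mul hh)
  rw [← e1, hs, e2]

/-! ### Unique midpoints in odd order -/

namespace IsAutomorphic
universe u

theorem eq_one_of_reflection_eq_inversion_aux (n : ℕ) : ∀ {Q : Type u} [Loop Q]
    (hQ : IsAutomorphic Q), Odd (Nat.card Q) → Nat.card Q = n → ∀ v : Q,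
      hQ.reflection v = hQ.inversion → v = 1 := by
  induction n using Nat.strong_induction_on with
  | _ n ih =>
  intro Q _ hQ hodd hn v hv
  have : Finite Q := Nat.finite_of_card_ne_zero fun h => by simp [h] at hodd
  by_cases hord : Odd (orderOf (leftTranslation v))
  -- `L_v²` is inner because `v² = 1`; in odd order `L_v` is a power of it, hence fixes `1`.
  · have hsq : leftTranslation v ^ 2 ∈ innerMappingGroup Q := by
      refine mem_innerMappingGroup.2 ⟨pow_mem (leftTranslation_mem v) 2, ?_⟩
      rw [pow_two, Equiv.Perm.mul_apply, leftTranslation_apply, leftTranslation_apply, mul_one]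
      exact ((hQ.reflection_eq_inversion_iff v).1 hv).1
    have := pow_mem hsq ((orderOf (leftTranslation v) + 1) / 2)
    rw [sq_pow_eq_self_of_odd (pow_orderOf_eq_one _) hord] at this
    simpa using map_one this
  · obtain ⟨k, hk1, hk2⟩ := exists_involution_pow _ (Nat.not_odd_iff_even.1 hord)
    set s := leftTranslation v ^ k with hs
    have hsm : s ∈ multiplicationGroup Q := pow_mem (leftTranslation_mem v) k
    -- An involution of an odd set has a fixed point; moving it to `1` turns `s` into an inner
    -- involution `t`.
    obtain ⟨⟨y, hy⟩⟩ : Nonempty {z : Q // s z = z} := by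
      have := (odd_card_fixed_of_involution hodd s hk2).pos
      exact (Nat.card_pos_iff.1 this).1
    set t := (leftTranslation y)⁻¹ * s * leftTranslation y with ht
    have htm : t ∈ innerMappingGroup Q := by
      refine mem_innerMappingGroup.2 ⟨mul_mem (mul_mem (inv_mem (leftTranslation_mem _)) hsm)
        (leftTranslation_mem _), ?_⟩
      have := leftTranslation_inv_mul y 1
      simp only [ht, Equiv.Perm.mul_apply, leftTranslation_apply, mul_one, hy]
      rwa [mul_one] at this
    have ht2 : t * t = 1 := by
      calc t * t = (leftTranslation y)⁻¹ * (s * s) * leftTranslation y := by rw [ht]; group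
        _ = 1 := by rw [hk2]; group
    have ht1 : t ≠ 1 := fun h => hk1 (by
      calc s = leftTranslation y * t * (leftTranslation y)⁻¹ := by rw [ht]; group
        _ = 1 := by rw [h]; group)
    have hfix : ∀ e : Q, hQ.reflection e = hQ.inversion → t e = e → e = 1 := by
      intro e he hte
      let := hQ.fixedLoop htm
      have hF := hQ.fixedLoop_isAutomorphic htm
      have hlt : Nat.card {z : Q // t z = z} < n := by
        rw [← hn]
        refine lt_of_le_of_ne (Nat.card_le_card_of_injective _ Subtype.val_injective) fun h => ?_
        have hb := (Nat.bijective_iff_injective_and_card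
          (Subtype.val : {z : Q // t z = z} → Q)).2 ⟨Subtype.val_injective, h⟩
        refine ht1 (Equiv.ext fun z => ?_)
        obtain ⟨w, rfl⟩ := hb.2 z
        exact w.2
      obtain ⟨h1, h2⟩ := (hQ.reflection_eq_inversion_iff e).1 he
      have := ih _ hlt hF (odd_card_fixed_of_involution hodd t ht2) rfl ⟨e, hte⟩
        ((hF.reflection_eq_inversion_iff _).2
          ⟨Subtype.ext h1, fun z => Subtype.ext (h2 z.1)⟩)
      exact congrArg Subtype.val this
    have htv : hQ.reflection (t v) = hQ.inversion := by
      rw [← hQ.conj_reflection (mem_innerMappingGroup.1 htm).1, hv,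
        (hQ.inner_commute_inversion htm).eq, mul_inv_cancel_right]
    obtain ⟨hvv, hvc⟩ := (hQ.reflection_eq_inversion_iff v).1 hv
    -- The product `v (t v)` is fixed by `t`, so induction makes it `1 = v v`, whence `t v = v` and
    -- induction applies to `v`.
    have hprod : hQ.reflection (v * t v) = hQ.inversion := by
      have := hQ.conj_reflection (leftTranslation_mem v) (t v)
      rw [htv] at this
      rw [← leftTranslation_apply, ← this]
      exact hv
    have h1 : v * t v = 1 := by
      apply hfix _ hprod
      have htt : t (t v) = v := congrArg (fun g : Equiv.Perm Q => g v) ht2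
      rw [hQ t htm, htt, hvc]
    exact hfix v hv (mul_left_cancel (h1.trans hvv.symm))

variable {Q : Type u} [Loop Q]

theorem eq_one_of_reflection_eq_inversion (hQ : IsAutomorphic Q) (hodd : Odd (Nat.card Q))
    {v : Q} (hv : hQ.reflection v = hQ.inversion) : v = 1 :=
  eq_one_of_reflection_eq_inversion_aux _ hQ hodd rfl v hv

/-- If `u² = 1`, then `P_u = L_u R_u⁻¹` is inner with square `1`, and `u` commutes with everything
in its fixed loop. -/
theorem eq_one_of_mul_self_eq_one (hQ : IsAutomorphic Q) (hodd : Odd (Nat.card Q))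
    {u : Q} (hu : u * u = 1) : u = 1 := by
  have hP := hQ.reflection_mul_inversion u
  rw [← eq_inverse_of_mul hu] at hP
  have hP2 := hQ.reflection_mul_inversion_sq u
  rw [hu, reflection_one, hQ.inversion_mul_self, pow_two] at hP2
  set t := hQ.reflection u * hQ.inversion with ht
  have happ : ∀ z, t (z * u) = u * z := fun z => by
    rw [hP, Equiv.Perm.mul_apply, rightTranslation_inv_apply_mul, leftTranslation_apply]
  have htm : t ∈ innerMappingGroup Q := by
    refine mem_innerMappingGroup.2 ⟨hQ.reflection_mul_inversion_mem u, ?_⟩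
    rw [← hu, happ]
  have htu : t u = u := by simpa using happ 1
  let := hQ.fixedLoop htm
  have hF := hQ.fixedLoop_isAutomorphic htm
  have := hF.eq_one_of_reflection_eq_inversion (odd_card_fixed_of_involution hodd t hP2)
    (v := ⟨u, htu⟩) ((hF.reflection_eq_inversion_iff _).2 ⟨Subtype.ext hu, fun z =>
      Subtype.ext (by
        change u * z.1 = z.1 * u
        rw [← happ, hQ t htm, z.2, htu])⟩)
  exact congrArg Subtype.val this

theorem odd_orderOf_reflection_mul_inversion (hQ : IsAutomorphic Q) (hodd : Odd (Nat.card Q))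
    (x : Q) : Odd (orderOf (hQ.reflection x * hQ.inversion)) := by
  have : Finite Q := Nat.finite_of_card_ne_zero fun h => by simp [h] at hodd
  by_contra hord
  obtain ⟨k, hk1, hk2⟩ := exists_involution_pow _ (Nat.not_odd_iff_even.1 hord)
  obtain ⟨u, hu⟩ := hQ.exists_pow_eq_reflection_mul_inversion x k
  rw [hu, ← pow_two, hQ.reflection_mul_inversion_sq, mul_eq_one_iff_eq_inv,
    hQ.inversion_inv] at hk2
  have h1 := hQ.eq_one_of_mul_self_eq_one hodd (hQ.eq_one_of_reflection_eq_inversion hodd hk2)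
  exact hk1 (by rw [hu, h1, reflection_one, hQ.inversion_mul_self])

theorem reflection_injective (hQ : IsAutomorphic Q) (hodd : Odd (Nat.card Q)) :
    Function.Injective hQ.reflection := by
  intro x y h
  have h1 : hQ.reflection ((leftTranslation x)⁻¹ y) = hQ.inversion := by
    rw [← hQ.conj_reflection (inv_mem (leftTranslation_mem x)), ← h]
    unfold reflection; group
  have h2 := hQ.eq_one_of_reflection_eq_inversion hodd h1
  have h3 := mul_leftTranslation_inv x y
  rwa [h2, mul_one] at h3

/-- Squaring is injective in an automorphic loop of odd order. -/
theorem mul_self_injective (hQ : IsAutomorphic Q) (hodd : Odd (Nat.card Q)) :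
    Function.Injective fun x : Q => x * x := by
  intro x y (h : x * x = y * y)
  have hs : (hQ.reflection x * hQ.inversion) ^ 2 = (hQ.reflection y * hQ.inversion) ^ 2 := by
    rw [hQ.reflection_mul_inversion_sq, hQ.reflection_mul_inversion_sq, h]
  apply hQ.reflection_injective hodd
  apply mul_right_cancel (b := hQ.inversion)
  exact (eq_of_sq_eq_sq_of_odd_orderOf (hQ.odd_orderOf_reflection_mul_inversion hodd x)
    (hQ.odd_orderOf_reflection_mul_inversion hodd y) hs)

theorem reflection_apply_injective (hQ : IsAutomorphic Q) (hodd : Odd (Nat.card Q)) (y : Q) :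
    Function.Injective fun m => hQ.reflection m y := by
  -- Translating `y` to `1` reduces the claim to `s_w 1 = w²`.
  have key : ∀ m, hQ.reflection m y =
      y * ((leftTranslation y)⁻¹ m * (leftTranslation y)⁻¹ m) := by
    intro m
    have h := hQ.conj_reflection (leftTranslation_mem y) ((leftTranslation y)⁻¹ m)
    rw [perm_apply_inv_self] at h
    have h1 := leftTranslation_inv_mul y 1
    rw [mul_one] at h1
    rw [← h, Equiv.Perm.mul_apply, Equiv.Perm.mul_apply, h1, reflection_apply_one,
      leftTranslation_apply]
  intro m n h
  simp only [key] at h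
  exact (leftTranslation y)⁻¹.injective (hQ.mul_self_injective hodd (mul_left_cancel h))

/-! ### Middle inner mappings of order two on a point -/

theorem eq_one_of_middleInner_apply_eq_inverse (hQ : IsAutomorphic Q) (hodd : Odd (Nat.card Q))
    {x u : Q} (h : middleInner x u = inverse u) : u = 1 := by
  have hxu : x * u = inverse u * x := by
    rw [← h]; exact (rightTranslation_inv_mul x (x * u)).symm
  have h1 := hQ.mul_self_mul x u
  conv_rhs at h1 => rw [hxu, leftTranslation_inv_mul]
  have h2 := hQ.mul_self_injective hodd h1
  exact mul_left_cancel (h2.trans (mul_one x).symm)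

theorem middleInner_apply_eq_self (hQ : IsAutomorphic Q) (hodd : Odd (Nat.card Q))
    {x y : Q} (h : middleInner x (middleInner x y) = y) : middleInner x y = y := by
  have : Finite Q := Nat.finite_of_card_ne_zero fun h => by simp [h] at hodd
  have hT := middleInner_mem x
  set t := middleInner x with ht
  -- `m` is the midpoint of `y` and `t y`. Since `t` swaps these, `t m` is a midpoint too.
  obtain ⟨m, hm⟩ := (Finite.injective_iff_surjective.1
    (hQ.reflection_apply_injective hodd y)) (t y)
  have htm : t m = m := by
    apply hQ.reflection_apply_injective hodd y
    have h1 : hQ.reflection (t m) (t y) = y := by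
      rw [← hQ.conj_reflection (mem_innerMappingGroup.1 hT).1 m, Equiv.Perm.mul_apply,
        perm_inv_apply_self, Equiv.Perm.mul_apply, show hQ.reflection m y = t y from hm, h]
    change hQ.reflection (t m) y = hQ.reflection m y
    rw [show hQ.reflection m y = t y from hm, ← hQ.reflection_inv (t m),
      Equiv.Perm.inv_eq_iff_eq, h1]
  have hmu := mul_leftTranslation_inv m y
  set u := (leftTranslation m)⁻¹ y with hu
  have h2 : m * inverse u = m * t u := by
    have h3 : t y = m * t u := by rw [← hmu, hQ t hT, htm]
    rw [← h3, ← hm]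
    rfl
  have hu1 := hQ.eq_one_of_middleInner_apply_eq_inverse hodd (mul_left_cancel h2).symm
  rw [hu1, mul_one] at hmu
  rw [← hmu, htm]

theorem commute_translations (hQ : IsAutomorphic Q) (x : Q) :
    Commute (leftTranslation x) (rightTranslation x) :=
  Equiv.ext fun y => hQ.flexible x y

end IsAutomorphic
end Loop

open Loop in
theorem corollary3p3 {Q : Type*} [Loop Q] (hQ : Loop.IsAutomorphic Q) (hodd : Odd (Nat.card Q)) :
    ∀ x y : Q, x * (x * y) = (y * x) * x ↔ x * y = y * x := by
  intro x y
  constructor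
  · intro h
    have h1 : middleInner x (middleInner x y) = y := by
      have hc := (hQ.commute_translations x).inv_right.eq
      have : middleInner x * middleInner x =
          (rightTranslation x)⁻¹ * ((rightTranslation x)⁻¹ *
            (leftTranslation x * leftTranslation x)) := by
        unfold middleInner
        rw [mul_assoc, ← mul_assoc (leftTranslation x), hc]
        simp only [mul_assoc]
      rw [← Equiv.Perm.mul_apply, this]
      simp only [Equiv.Perm.mul_apply, leftTranslation_apply, h, rightTranslation_inv_apply_mul]
    have h2 := hQ.middleInner_apply_eq_self hodd h1
    conv_rhs => rw [← h2]
    exact (rightTranslation_inv_mul x (x * y)).symm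
  · intro h
    rw [← h, ← hQ.flexible, h]
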